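/- Let $k$ be a perfect field of characteristic $p>0$, let $R=k[x_1,\dots,x_n]$ be a polynomial ring, and let $I\subseteq R$ be an ideal of height $c<\infty$ (so $I\neq R$) that is unmixed, i.e. all associated primes of $R/I$ have the same height. Let $f_1,\dots,f_s$ be any generators of $I$, let $S=R[u_{ij}\mid 1\le i\le c,\ 1\le j\le s]$ be a polynomial ring in $cs$ new variables, put $g_i=\sum_{j=1}^s u_{ij}f_j$ for $1\le i\le c$, and let $J=(g_1,\dots,g_c):_S IS$ be the generic link of $I$ with respect to $f_1,\dots,f_s$. For a commutative ring $A$ of characteristic $p$, let $F^e_*A$ denote $A$ regarded as an $A$-module through the $e$-th Frobenius $a\mapsto a^{p^e}$. For an ideal $\mathfrak a\subseteq A$ and a real number $t\ge 0$, the pair $(A,\mathfrak a^t)$ is called $F$-pure if for all sufficiently large $e$ there is $d\in\mathfrak a^{\lfloor t(p^e-1)\rfloor}$ such that the $A$-linear map $A\to F^e_*A$, $1\mapsto F^e_*d$, splits. The $F$-pure threshold is $$\mathrm{fpt}_A(\mathfrak a)=\sup\{t\in\mathbb R_{\ge 0} : (A,\mathfrak a^t)\text{ is }F\text{-pure}\}\in[0,\infty].$$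 An ideal $K\subseteq I$ is a reduction of $I$ if $I^{m+1}=K I^m$ for some $m\ge 0$. Then the following hold. 1. If $I$ has a reduction generated by $r$ elements, then $\mathrm{fpt}_S(J)\ge \frac{c}{r}\,\mathrm{fpt}_R(I)$. 2. If $I$ has a reduction generated by $c$ elements, then $\mathrm{fpt}_S(J)\ge \mathrm{fpt}_R(I)$. In particular, this holds if $I$ is a complete intersection, i.e. generated by a regular sequence. 3. In general, $\mathrm{fpt}_S(J)\ge \frac{c}{n}\,\mathrm{fpt}_R(I)$. (If $r=0$ in 1 or $n=0$ in 3, then $I=0$ and $c=0$, and the fraction $\frac{0}{0}$ is read as $0$. If $c=0$, then $I=0$ and $J=S$, whose $F$-pure threshold is $\infty$.) -/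

import Mathlib

open scoped NNReal ENNReal

noncomputable section

namespace GenericLinkage

/-- The target `F^e_* R` of the `e`-th Frobenius endomorphism of `R`: the additive group of `R`,
on which `R` acts through the `e`-th iterate of Frobenius. -/
def FrobeniusPushforward (R : Type*) (_p _e : ℕ) : Type _ := R

instance (R : Type*) [CommRing R] (p e : ℕ) : AddCommGroup (FrobeniusPushforward R p e) :=
  inferInstanceAs (AddCommGroup R)

/-- `a • F^e_* x = F^e_* (a ^ (p ^ e) * x)`. -/
instance (R : Type*) [CommRing R] (p e : ℕ) [ExpChar R p] :
    Module R (FrobeniusPushforward R p e) :=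
  Module.compHom R (iterateFrobenius R p e)

/-- The element `F^e_* d` of `F^e_* R`. -/
def FrobeniusPushforward.of {R : Type*} (p e : ℕ) (d : R) : FrobeniusPushforward R p e := d

theorem FrobeniusPushforward.smul_of {R : Type*} [CommRing R] (p e : ℕ) [ExpChar R p] (a d : R) :
    a • FrobeniusPushforward.of p e d = FrobeniusPushforward.of p e (a ^ p ^ e * d) := rfl

/-- The `R`-linear map `R → F^e_* R`, `1 ↦ F^e_* d`, splits. -/
def FrobeniusSplitsAt {R : Type*} [CommRing R] (p e : ℕ) [ExpChar R p] (d : R) : Prop :=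
  ∃ φ : FrobeniusPushforward R p e →ₗ[R] R,
    φ ∘ₗ LinearMap.toSpanSingleton R _ (FrobeniusPushforward.of p e d) = LinearMap.id

/-- The pair `(R, I ^ t)` is `F`-pure: for all large `e` there is `d ∈ I ^ ⌊t (p ^ e - 1)⌋` such
that `R → F^e_* R`, `1 ↦ F^e_* d`, splits. -/
def IsFPurePair {R : Type*} [CommRing R] (p : ℕ) [ExpChar R p] (I : Ideal R) (t : ℝ≥0) : Prop :=
  ∀ᶠ e : ℕ in Filter.atTop, ∃ d ∈ I ^ ⌊(t : ℝ) * ((p : ℝ) ^ e - 1)⌋₊, FrobeniusSplitsAt p e d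

/-- The `F`-pure threshold of `(R, I)`, as a supremum in `[0, ∞]`. -/
def fpt {R : Type*} [CommRing R] (p : ℕ) [ExpChar R p] (I : Ideal R) : ℝ≥0∞ :=
  ⨆ (t : ℝ≥0) (_ : IsFPurePair p I t), (t : ℝ≥0∞)

/-- All associated primes of `I` have the same height. -/
def IsUnmixed {R : Type*} [CommRing R] (I : Ideal R) : Prop :=
  ∀ P ∈ associatedPrimes R (R ⧸ I), ∀ Q ∈ associatedPrimes R (R ⧸ I), P.height = Q.height

/-- `K` is a reduction of `I`. -/
def IsReduction {R : Type*} [CommRing R] (K I : Ideal R) : Prop :=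
  K ≤ I ∧ ∃ m : ℕ, I ^ (m + 1) = K * I ^ m

/-- `I` can be generated by a regular sequence. -/
def IsCompleteIntersection {R : Type*} [CommRing R] (I : Ideal R) : Prop :=
  ∃ l : List R, RingTheory.Sequence.IsRegular R l ∧ Ideal.ofList l = I

/-- The generic combinations `g_i = u_{i1} f_1 + ⋯ + u_{is} f_s` in `S = R[u_{ij}]`,
`1 ≤ i ≤ c`, `1 ≤ j ≤ s`. -/
def genericCombination {R : Type*} [CommRing R] (c : ℕ) {s : ℕ} (f : Fin s → R) (i : Fin c) :
    MvPolynomial (Fin c × Fin s) R :=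
  ∑ j : Fin s, MvPolynomial.X (i, j) * MvPolynomial.C (f j)

/-- The generic link `J = (g_1, …, g_c) : I S` in `S = R[u_{ij}]` of the ideal
`I = (f_1, …, f_s)` with respect to the generators `f_1, …, f_s`. -/
def genericLink {R : Type*} [CommRing R] (c : ℕ) {s : ℕ} (f : Fin s → R) :
    Ideal (MvPolynomial (Fin c × Fin s) R) :=
  Submodule.colon (Ideal.span (Set.range (genericCombination c f)))
    ((Ideal.span (Set.range f)).map
      (MvPolynomial.C : R →+* MvPolynomial (Fin c × Fin s) R) :
        Set (MvPolynomial (Fin c × Fin s) R))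

end GenericLinkage

end

noncomputable section

namespace GenericLinkage

open MvPolynomial

/-! Write `q = p ^ e` and `M^[q]` for the Frobenius power of `M`. The link contains the generic
combinations `g_i`, so it is enough to find a splitting element in a high power of `(g_1, …, g_c)`.
The candidate is the sum of all `∏ g_i ^ β_i` with `β_i < q` and `∑ β_i ≥ N`. The degree in row `i`
of the `u i j` recovers `β_i`, so the summands do not interfere, and a `q⁻¹`-linear map of `R` lifts
to one of `S` that isolates a single coefficient (`genericCartierIdeal_le`). The element therefore
splits once the values of such maps at the coefficients generate the unit ideal of `R`.

For `N = ⌈t' q⌉` these ideals of values increase with `e`, so by the Nullstellensatz each point `a`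
over an algebraically closed field may be treated separately. If `M` is its maximal ideal,
specializing the `u i j` reduces the claim to finding `c` elements of the extended `I` with `∏ h_i ^
β_i ∉ M^[q]`, `β_i < q` and `∑ β_i ≥ N` (`exists_mem_genericCartierIdeal_map_notMem`).

Off `V(I)`, a function of `I` not vanishing at `a` serves. On `V(I)`, `F`-purity says that a high
power of `I` is not contained in `M^[q]`. A local reduction with `r` generators turns this into a
monomial in those generators outside `M^[q]`, and the best `c` of the `r` exponents carry at least
`c / r` of its degree (`HasReductionModulo.exists_prod_pow_notMem`). In general `r = n` is allowed,
because the local analytic spread is at most `n` (`hasReductionModulo_of_infinite`). -/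

/-- An additive endomorphism `φ` of `A` with `φ (a ^ q * x) = a * φ x`. For `q = p ^ e` these are
the `A`-linear maps `F^e_* A → A`. -/
def IsCartierMap {A : Type*} [CommRing A] (q : ℕ) (φ : A →+ A) : Prop :=
  ∀ a x, φ (a ^ q * x) = a * φ x

/-! ### `q⁻¹`-linear maps and their values -/

section CartierMap

variable {A : Type*} [CommRing A] {q : ℕ}

theorem frobeniusSplitsAt_iff {p e : ℕ} [ExpChar A p] {d : A} :
    FrobeniusSplitsAt p e d ↔ ∃ φ : A →+ A, IsCartierMap (p ^ e) φ ∧ φ d = 1 := by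
  constructor
  · rintro ⟨φ, h⟩
    refine ⟨φ.toAddMonoidHom, fun a x => φ.map_smul a (FrobeniusPushforward.of p e x), ?_⟩
    have h1 := LinearMap.congr_fun h 1
    simp only [LinearMap.comp_apply, LinearMap.toSpanSingleton_apply, one_smul,
      LinearMap.id_apply] at h1
    exact h1
  · rintro ⟨φ, hφ, h⟩
    refine ⟨{ toFun := fun x => φ x, map_add' := fun x y => φ.map_add x y,
              map_smul' := fun a x => hφ a x }, ?_⟩
    ext
    simp only [LinearMap.comp_apply, LinearMap.toSpanSingleton_apply, one_smul, LinearMap.id_apply]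
    exact h

theorem IsCartierMap.zero : IsCartierMap q (0 : A →+ A) := fun a x => by simp

theorem IsCartierMap.add {φ ψ : A →+ A} (hφ : IsCartierMap q φ) (hψ : IsCartierMap q ψ) :
    IsCartierMap q (φ + ψ) := fun a x => by
  simp [hφ a x, hψ a x, mul_add]

theorem IsCartierMap.smul {φ : A →+ A} (hφ : IsCartierMap q φ) (b : A) :
    IsCartierMap q ((AddMonoidHom.mulLeft b).comp φ) := fun a x => by
  simp [hφ a x, mul_left_comm]

theorem IsCartierMap.comp {q' : ℕ} {φ ψ : A →+ A} (hφ : IsCartierMap q φ)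
    (hψ : IsCartierMap q' ψ) : IsCartierMap (q * q') (φ.comp ψ) := fun a x => by
  simp [pow_mul, hψ (a ^ q) x, hφ a]

/-- The ideal of all values at `d` of `p ^ {-e}`-linear maps. -/
def cartierIdeal (q : ℕ) (d : A) : Ideal A where
  carrier := {y | ∃ φ : A →+ A, IsCartierMap q φ ∧ φ d = y}
  zero_mem' := ⟨0, .zero, rfl⟩
  add_mem' := by
    rintro _ _ ⟨φ, hφ, rfl⟩ ⟨ψ, hψ, rfl⟩
    exact ⟨φ + ψ, hφ.add hψ, rfl⟩
  smul_mem' := by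
    rintro b _ ⟨φ, hφ, rfl⟩
    exact ⟨_, hφ.smul b, rfl⟩

theorem mem_cartierIdeal {d y : A} :
    y ∈ cartierIdeal q d ↔ ∃ φ : A →+ A, IsCartierMap q φ ∧ φ d = y := Iff.rfl

theorem frobeniusSplitsAt_iff_cartierIdeal {p e : ℕ} [ExpChar A p] {d : A} :
    FrobeniusSplitsAt p e d ↔ 1 ∈ cartierIdeal (p ^ e) d := frobeniusSplitsAt_iff

/-- `p ^ {-e}`-linear maps send the Frobenius power of an ideal into the ideal. -/
theorem IsCartierMap.map_mem {p e : ℕ} [ExpChar A p] {φ : A →+ A}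
    (hφ : IsCartierMap (p ^ e) φ) {M : Ideal A} {x : A} (hx : x ∈ M.map (iterateFrobenius A p e)) :
    φ x ∈ M := by
  -- The free factor `b` makes the condition stable under multiplication, since `φ` itself is not
  -- linear over the ring.
  suffices h : ∀ b, φ (b * x) ∈ M by simpa using h 1
  refine Submodule.span_induction (p := fun x _ => ∀ b, φ (b * x) ∈ M) ?_ ?_ ?_ ?_ hx
  · rintro _ ⟨y, hy, rfl⟩ b
    rw [iterateFrobenius_def, mul_comm, hφ]
    exact M.mul_mem_right _ hy
  · simp
  · intro x y _ _ h1 h2 b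
    rw [mul_add, map_add]
    exact M.add_mem (h1 b) (h2 b)
  · intro a x _ h b
    rw [smul_eq_mul, ← mul_assoc]
    exact h _

theorem pow_mem_map_iterateFrobenius {p : ℕ} (e : ℕ) [ExpChar A p] {M : Ideal A} {x : A}
    (hx : x ∈ M) : x ^ p ^ e ∈ M.map (iterateFrobenius A p e) := by
  rw [← iterateFrobenius_def]
  exact Ideal.mem_map_of_mem _ hx

theorem exists_pow_le_map_iterateFrobenius {p : ℕ} (e : ℕ) [ExpChar A p] {M : Ideal A}
    (hM : M.FG) : ∃ k, M ^ k ≤ M.map (iterateFrobenius A p e) :=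
  Ideal.exists_pow_le_of_le_radical_of_fg
    (fun _ hx => ⟨p ^ e, pow_mem_map_iterateFrobenius e hx⟩) hM

end CartierMap

/-! ### Lifting `q⁻¹`-linear maps to polynomial rings -/

section Lift

variable {A : Type*} [CommRing A] {σ : Type*} {q : ℕ}

theorem nsmul_add_injective (hq : q ≠ 0) (ρ : σ →₀ ℕ) :
    Function.Injective fun ε : σ →₀ ℕ => q • ε + ρ := by
  intro a b h
  ext i
  have := DFunLike.congr_fun h i
  simpa [hq] using this

/-- The additive map on polynomials which applies `φ` to the coefficients of the monomials
`X ^ (q ε + ρ)`, which it sends to `X ^ ε`, and kills all other monomials. -/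
def cartierLift (hq : q ≠ 0) (φ : A →+ A) (ρ : σ →₀ ℕ) : MvPolynomial σ A →+ MvPolynomial σ A :=
  AddMonoidHom.mk' (fun x => AddMonoidAlgebra.map φ
    (AddMonoidAlgebra.comapDomain (fun ε : σ →₀ ℕ => q • ε + ρ) (nsmul_add_injective hq ρ) x))
    fun x y => by
      rw [AddMonoidAlgebra.comapDomain_add, AddMonoidAlgebra.map_add]

theorem coeff_cartierLift (hq : q ≠ 0) (φ : A →+ A) (ρ ε : σ →₀ ℕ) (x : MvPolynomial σ A) :
    coeff ε (cartierLift hq φ ρ x) = φ (coeff (q • ε + ρ) x) := by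
  simp only [coeff, cartierLift, AddMonoidHom.mk'_apply, AddMonoidAlgebra.coeff_map,
    AddMonoidAlgebra.coeff_comapDomain]
  rfl

theorem isCartierMap_cartierLift {p e : ℕ} [ExpChar A p] (hq : p ^ e ≠ 0) {φ : A →+ A}
    (hφ : IsCartierMap (p ^ e) φ) {ρ : σ →₀ ℕ} (hρ : ∀ i, ρ i < p ^ e) :
    IsCartierMap (p ^ e) (cartierLift hq φ ρ) := by
  intro a
  induction a using MvPolynomial.induction_on with
  | C a =>
    intro x
    ext ε
    rw [coeff_cartierLift, ← C_pow, coeff_C_mul, coeff_C_mul, coeff_cartierLift, hφ]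
  | add a b ha hb =>
    intro x
    rw [add_pow_expChar_pow, add_mul, map_add, ha, hb, add_mul]
  | mul_X a i ha =>
    intro x
    rw [mul_pow, mul_assoc, ha, mul_assoc]
    congr 1
    ext ε
    rw [coeff_cartierLift, X_pow_eq_monomial, coeff_monomial_mul', X, coeff_monomial_mul',
      coeff_cartierLift]
    -- Because `ρ i < q`, the exponent `q * ε i + ρ i` reaches `q` exactly when `ε i` is positive.
    have key : Finsupp.single i (p ^ e) ≤ p ^ e • ε + ρ ↔ Finsupp.single i 1 ≤ ε := by
      rw [Finsupp.single_le_iff, Finsupp.single_le_iff]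
      simp only [Finsupp.add_apply, Finsupp.smul_apply, smul_eq_mul]
      have := hρ i
      constructor
      · intro h
        by_contra h0
        have : ε i = 0 := by omega
        simp only [this, mul_zero, zero_add] at h
        omega
      · intro h
        exact le_add_right (Nat.le_mul_of_pos_right _ h)
    simp only [key, one_mul]
    split_ifs with h
    · obtain ⟨ε', rfl⟩ := exists_add_of_le h
      congr 2
      simp [smul_add, add_assoc]
    · exact map_zero φ

end Lift

/-! ### The monomial basis of the Frobenius pushforward over a perfect field -/

section Perfect

variable {K : Type*} [Field K] {σ : Type*} (p : ℕ) [ExpChar K p] [PerfectRing K p] (e : ℕ)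

theorem expChar_pow_ne_zero (K : Type*) [Field K] (p : ℕ) [ExpChar K p] (e : ℕ) : p ^ e ≠ 0 :=
  (expChar_pow_pos K p e).ne'

/-- The inverse of the `e`-th Frobenius of a perfect field. -/
def frobeniusRoot : K →+ K := (iterateFrobeniusEquiv K p e).symm.toRingHom.toAddMonoidHom

theorem frobeniusRoot_pow (a : K) : frobeniusRoot p e (a ^ p ^ e) = a :=
  (iterateFrobeniusEquiv K p e).symm_apply_apply a

theorem pow_frobeniusRoot (a : K) : frobeniusRoot p e a ^ p ^ e = a :=
  (iterateFrobeniusEquiv K p e).apply_symm_apply a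

theorem isCartierMap_frobeniusRoot : IsCartierMap (p ^ e) (frobeniusRoot p e : K →+ K) := by
  intro a x
  conv_lhs => rw [← pow_frobeniusRoot p e x, ← mul_pow, frobeniusRoot_pow]

theorem map_frobeniusRoot {L : Type*} [Field L] [ExpChar L p] [PerfectRing L p] (f : K →+* L)
    (a : K) : f (frobeniusRoot p e a) = frobeniusRoot p e (f a) := by
  conv_rhs => rw [← pow_frobeniusRoot p e a, map_pow, frobeniusRoot_pow]

/-- The coordinate at `X ^ ρ` with respect to the monomial basis of `F^e_* K[X]` over `K[X]`. -/
def cartierCoeff (ρ : σ →₀ ℕ) : MvPolynomial σ K →+ MvPolynomial σ K :=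
  cartierLift (expChar_pow_ne_zero K p e) (frobeniusRoot p e) ρ

theorem coeff_cartierCoeff (ρ ε : σ →₀ ℕ) (x : MvPolynomial σ K) :
    coeff ε (cartierCoeff p e ρ x) = frobeniusRoot p e (coeff (p ^ e • ε + ρ) x) :=
  coeff_cartierLift ..

theorem isCartierMap_cartierCoeff {ρ : σ →₀ ℕ} (hρ : ∀ i, ρ i < p ^ e) :
    IsCartierMap (p ^ e) (cartierCoeff p e ρ : MvPolynomial σ K →+ _) :=
  isCartierMap_cartierLift _ (isCartierMap_frobeniusRoot p e) hρ

theorem map_cartierCoeff {L : Type*} [Field L] [ExpChar L p] [PerfectRing L p] (f : K →+* L)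
    (ρ : σ →₀ ℕ) (x : MvPolynomial σ K) :
    map f (cartierCoeff p e ρ x) = cartierCoeff p e ρ (map f x) := by
  ext ε
  simp [coeff_map, coeff_cartierCoeff, map_frobeniusRoot]

theorem cartierCoeff_zero_one : cartierCoeff p e (0 : σ →₀ ℕ) (1 : MvPolynomial σ K) = 1 := by
  classical
  have hq := expChar_pow_ne_zero K p e
  ext ε
  rw [coeff_cartierCoeff, coeff_one, coeff_one]
  have : (0 = p ^ e • ε + 0) ↔ 0 = ε := by
    rw [add_zero, eq_comm, smul_eq_zero_iff_right hq, eq_comm]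
  simp only [this]
  split_ifs
  · simpa using frobeniusRoot_pow p e (1 : K)
  · exact map_zero _

theorem one_mem_cartierIdeal_one : (1 : MvPolynomial σ K) ∈ cartierIdeal (p ^ e) 1 :=
  ⟨_, isCartierMap_cartierCoeff p e fun _ => by
    simpa using expChar_pow_pos K p e, cartierCoeff_zero_one p e⟩

theorem cartierCoeff_monomial_self (ρ ε : σ →₀ ℕ) (a : K) :
    cartierCoeff p e ρ (monomial (p ^ e • ε + ρ) a) = monomial ε (frobeniusRoot p e a) := by
  classical
  ext ε'
  have h : p ^ e • ε + ρ = p ^ e • ε' + ρ ↔ ε = ε' :=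
    (nsmul_add_injective (expChar_pow_ne_zero K p e) ρ).eq_iff
  simp only [coeff_cartierCoeff, coeff_monomial, h]
  split_ifs <;> simp

theorem cartierCoeff_monomial_of_ne (ρ γ : σ →₀ ℕ) (a : K) (h : ∀ ε, p ^ e • ε + ρ ≠ γ) :
    cartierCoeff p e ρ (monomial γ a) = 0 := by
  classical
  ext ε'
  rw [coeff_cartierCoeff, coeff_monomial, if_neg (h ε').symm, map_zero, coeff_zero]

/-- Division with remainder of the exponents by `q` splits a monomial into a `q`-th power and a
reduced monomial; perfectness supplies the root of the coefficient. -/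
theorem sum_cartierCoeff_pow_mul_monomial [Fintype σ] [DecidableEq σ] (x : MvPolynomial σ K) :
    ∑ ρ : σ → Fin (p ^ e), cartierCoeff p e (Finsupp.equivFunOnFinite.symm fun i => (ρ i : ℕ)) x
      ^ p ^ e * monomial (Finsupp.equivFunOnFinite.symm fun i => (ρ i : ℕ)) 1 = x := by
  have hq := expChar_pow_pos K p e
  induction x using MvPolynomial.induction_on' with
  | monomial γ a =>
    let ρ : σ → Fin (p ^ e) := fun i => ⟨γ i % p ^ e, Nat.mod_lt _ hq⟩
    let ε : σ →₀ ℕ := Finsupp.equivFunOnFinite.symm fun i => γ i / p ^ e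
    have hγ : p ^ e • ε + Finsupp.equivFunOnFinite.symm (fun i => (ρ i : ℕ)) = γ := by
      ext i
      exact Nat.div_add_mod _ _
    rw [Finset.sum_eq_single ρ]
    · conv_lhs => rw [← hγ, cartierCoeff_monomial_self]
      rw [monomial_pow, pow_frobeniusRoot, monomial_mul, mul_one, hγ]
    · intro ρ' _ hne
      rw [cartierCoeff_monomial_of_ne, zero_pow hq.ne', zero_mul]
      rintro ε' rfl
      apply hne
      ext i
      simp [ρ, Nat.mod_eq_of_lt (ρ' i).2]
    · simp
  | add x y hx hy =>
    conv_rhs => rw [← hx, ← hy]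
    simp only [map_add, add_pow_expChar_pow, add_mul, Finset.sum_add_distrib]

/-- A polynomial lies in the Frobenius power of the ideal of its `p ^ {-e}`-linear coordinates. -/
theorem mem_map_iterateFrobenius_span_cartierCoeff [Finite σ] (x : MvPolynomial σ K) :
    x ∈ (Ideal.span {y | ∃ ρ : σ →₀ ℕ, (∀ i, ρ i < p ^ e) ∧ cartierCoeff p e ρ x = y}).map
      (iterateFrobenius (MvPolynomial σ K) p e) := by
  classical
  cases nonempty_fintype σ
  have key : ∀ J : Ideal (MvPolynomial σ K),
      (∀ ρ : σ →₀ ℕ, (∀ i, ρ i < p ^ e) → cartierCoeff p e ρ x ^ p ^ e ∈ J) → x ∈ J := by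
    intro J hJ
    rw [← sum_cartierCoeff_pow_mul_monomial p e x]
    exact Ideal.sum_mem _ fun ρ _ => Ideal.mul_mem_right _ _ (hJ _ fun i => (ρ i).2)
  exact key _ fun ρ hρ => pow_mem_map_iterateFrobenius e (Ideal.subset_span ⟨ρ, hρ, rfl⟩)

theorem exists_cartierCoeff_notMem [Finite σ] {M : Ideal (MvPolynomial σ K)} {x : MvPolynomial σ K}
    (hx : x ∉ M.map (iterateFrobenius (MvPolynomial σ K) p e)) :
    ∃ ρ : σ →₀ ℕ, (∀ i, ρ i < p ^ e) ∧ cartierCoeff p e ρ x ∉ M := by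
  by_contra! h
  refine hx (Ideal.map_mono (Ideal.span_le.2 ?_) (mem_map_iterateFrobenius_span_cartierCoeff p e x))
  rintro _ ⟨ρ, hρ, rfl⟩
  exact h ρ hρ

/-- If some `p ^ {-e}`-linear map has the value `1` at `d`, then `d` does not lie in the Frobenius
power of a proper ideal, even after an extension of the base field. -/
theorem map_notMem_of_one_mem_cartierIdeal [Finite σ] {L : Type*} [Field L] [ExpChar L p]
    [PerfectRing L p] (f : K →+* L) {M : Ideal (MvPolynomial σ L)} (hM : M ≠ ⊤)
    {d : MvPolynomial σ K} (hd : 1 ∈ cartierIdeal (p ^ e) d) :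
    map f d ∉ M.map (iterateFrobenius (MvPolynomial σ L) p e) := by
  intro h
  obtain ⟨φ, hφ, h1⟩ := hd
  -- Every value of a `q⁻¹`-linear map at `d` lies in the ideal of coordinates of `d`, so this ideal
  -- is the unit ideal. Coordinates commute with field extension, which carries the conclusion to
  -- `L`.
  have h2 := hφ.map_mem (mem_map_iterateFrobenius_span_cartierCoeff p e d)
  rw [h1] at h2
  have h3 := Ideal.mem_map_of_mem (map f) h2
  rw [map_one] at h3
  refine hM (M.eq_top_of_isUnit_mem (x := 1) ?_ isUnit_one)
  refine Ideal.map_le_iff_le_comap.2 (Ideal.span_le.2 ?_) h3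
  rintro _ ⟨ρ, hρ, rfl⟩
  change map f _ ∈ M
  rw [map_cartierCoeff]
  exact (isCartierMap_cartierCoeff p e hρ).map_mem h

end Perfect

/-! ### Products of the generic combinations and their coefficients -/

section GenericCombination

variable {A : Type*} [CommRing A] {c s : ℕ}

/-- The product of powers of the generic combinations with exponents `β`. -/
def genericProd (f : Fin s → A) (β : Fin c → ℕ) : MvPolynomial (Fin c × Fin s) A :=
  ∏ i, genericCombination c f i ^ β i

/-- The row degree of a monomial in the variables `u i j`. -/
def rowWeight (c s : ℕ) (x : Fin c × Fin s) : Fin c → ℕ := Pi.single x.1 1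

theorem weight_rowWeight (γ : Fin c × Fin s →₀ ℕ) (i : Fin c) :
    Finsupp.weight (rowWeight c s) γ i = ∑ j, γ (i, j) := by
  rw [Finsupp.weight_apply, Finsupp.sum_fintype _ _ (fun x => zero_smul ℕ (rowWeight c s x)), Finset.sum_apply,
    Fintype.sum_prod_type, Finset.sum_eq_single i]
  · simp [rowWeight]
  · intro i' _ h
    simp [rowWeight, h.symm]
  · simp

/-- Since `g_i` is linear in row `i`, a monomial in the `u i j` determines the only `β` whose
product can contain it. This excludes cancellation in `genericSum`. -/
theorem isWeightedHomogeneous_genericProd (f : Fin s → A) (β : Fin c → ℕ) :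
    IsWeightedHomogeneous (rowWeight c s) (genericProd f β) β := by
  have h1 : ∀ i, IsWeightedHomogeneous (rowWeight c s) (genericCombination c f i)
      (Pi.single i 1) := fun i =>
    IsWeightedHomogeneous.sum _ _ _ fun j _ => by
      have := (isWeightedHomogeneous_X A (rowWeight c s) (i, j)).mul
        (isWeightedHomogeneous_C (rowWeight c s) (f j))
      simpa [rowWeight] using this
  have h2 := IsWeightedHomogeneous.prod Finset.univ (fun i => genericCombination c f i ^ β i)
    (fun i => β i • Pi.single i 1) (fun i _ => (h1 i).pow (β i))
  have h3 : ∑ i, β i • (Pi.single i 1 : Fin c → ℕ) = β := by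
    ext i
    simp [Finset.sum_apply, Pi.single_apply]
  rwa [h3] at h2

theorem sum_eq_of_coeff_genericProd_ne_zero {f : Fin s → A} {β : Fin c → ℕ}
    {γ : Fin c × Fin s →₀ ℕ} (h : coeff γ (genericProd f β) ≠ 0) (i : Fin c) :
    ∑ j, γ (i, j) = β i := by
  rw [← weight_rowWeight, isWeightedHomogeneous_genericProd f β h]

theorem le_of_coeff_genericProd_ne_zero {f : Fin s → A} {β : Fin c → ℕ}
    {γ : Fin c × Fin s →₀ ℕ} (h : coeff γ (genericProd f β) ≠ 0) (x : Fin c × Fin s) :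
    γ x ≤ β x.1 := by
  rw [← sum_eq_of_coeff_genericProd_ne_zero h x.1]
  exact Finset.single_le_sum (f := fun j => γ (x.1, j)) (fun _ _ => Nat.zero_le _)
    (Finset.mem_univ x.2)

theorem genericProd_mem_pow (f : Fin s → A) (β : Fin c → ℕ) :
    genericProd f β ∈ Ideal.span (Set.range (genericCombination c f)) ^ ∑ i, β i := by
  rw [← Finset.prod_pow_eq_pow_sum]
  exact Ideal.prod_mem_prod fun i _ =>
    Ideal.pow_mem_pow (Ideal.subset_span (Set.mem_range_self i)) _

theorem span_genericCombination_le_genericLink (f : Fin s → A) :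
    Ideal.span (Set.range (genericCombination c f)) ≤ genericLink c f := by
  intro x hx
  rw [genericLink, Submodule.mem_colon]
  intro y _
  exact Ideal.mul_mem_right _ _ hx

/-- Specializing the variables `u i j` gives all products of powers of elements of the ideal
spanned by `f`. -/
theorem eval₂_genericProd {B : Type*} [CommRing B] (φ : A →+* B) (a : Fin c → Fin s → B)
    (f : Fin s → A) (β : Fin c → ℕ) :
    eval₂ φ (fun x => a x.1 x.2) (genericProd f β) = ∏ i, (∑ j, a i j * φ (f j)) ^ β i := by
  simp [genericProd, genericCombination, eval₂_prod, eval₂_pow, eval₂_sum]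

/-- The sum of all products of powers of the generic combinations with exponents less than `q` and
total degree at least `N`. -/
def genericSum (c : ℕ) (f : Fin s → A) (q N : ℕ) : MvPolynomial (Fin c × Fin s) A :=
  ∑ β : Fin c → Fin q with N ≤ ∑ i, (β i : ℕ), genericProd f fun i => (β i : ℕ)

theorem genericSum_mem_pow (f : Fin s → A) (q N : ℕ) :
    genericSum c f q N ∈ Ideal.span (Set.range (genericCombination c f)) ^ N :=
  Ideal.sum_mem _ fun _ hβ =>
    Ideal.pow_le_pow_right (Finset.mem_filter.1 hβ).2 (genericProd_mem_pow f _)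

theorem coeff_genericSum {f : Fin s → A} {β : Fin c → ℕ} {q N : ℕ} (hβ : ∀ i, β i < q)
    (hN : N ≤ ∑ i, β i) {γ : Fin c × Fin s →₀ ℕ} (hγ : ∀ i, ∑ j, γ (i, j) = β i) :
    coeff γ (genericSum c f q N) = coeff γ (genericProd f β) := by
  rw [genericSum, coeff_sum, Finset.sum_eq_single (fun i => ⟨β i, hβ i⟩)]
  · intro β' _ hne
    by_contra h0
    apply hne
    ext i
    rw [← sum_eq_of_coeff_genericProd_ne_zero h0 i, hγ]
  · intro h
    simp [hN] at h

theorem coeff_genericSum_eq_zero {f : Fin s → A} {q N : ℕ} {γ : Fin c × Fin s →₀ ℕ}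
    {x : Fin c × Fin s} (hx : q ≤ γ x) : coeff γ (genericSum c f q N) = 0 := by
  rw [genericSum, coeff_sum]
  refine Finset.sum_eq_zero fun β _ => ?_
  by_contra h0
  exact (le_of_coeff_genericProd_ne_zero h0 x).not_gt ((β x.1).2.trans_le hx)

/-- The ideal generated by the values of `p ^ {-e}`-linear maps at the coefficients of the products
of powers of the generic combinations with exponents less than `q` and total degree at
least `N`. -/
def genericCartierIdeal (c : ℕ) (f : Fin s → A) (q N : ℕ) : Ideal A :=
  Ideal.span {y | ∃ β : Fin c → ℕ, (∀ i, β i < q) ∧ N ≤ ∑ i, β i ∧ ∃ γ,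
    y ∈ cartierIdeal q (coeff γ (genericProd f β))}

theorem genericCartierIdeal_le {p e : ℕ} [ExpChar A p] (hq : p ^ e ≠ 0) (f : Fin s → A) (N : ℕ) :
    genericCartierIdeal c f (p ^ e) N ≤
      (cartierIdeal (p ^ e) (genericSum c f (p ^ e) N)).comap C := by
  refine Ideal.span_le.2 ?_
  rintro _ ⟨β, hβ, hN, γ, φ, hφ, rfl⟩
  change C (φ _) ∈ cartierIdeal _ _
  by_cases h0 : coeff γ (genericProd f β) = 0
  · simp [h0]
  -- The lift at `γ` reads the coefficients at `γ + q ε`. For `ε ≠ 0` they vanish, as no exponent in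
  -- `genericSum` reaches `q`, so only the constant `φ (coeff γ)` remains.
  refine ⟨cartierLift hq φ γ, isCartierMap_cartierLift hq hφ fun x =>
    (le_of_coeff_genericProd_ne_zero h0 x).trans_lt (hβ _), ?_⟩
  ext ε
  classical
  rw [coeff_cartierLift, coeff_C]
  split_ifs with hε
  · subst hε
    rw [smul_zero, zero_add, coeff_genericSum hβ hN (sum_eq_of_coeff_genericProd_ne_zero h0)]
  · obtain ⟨x, hx⟩ : ∃ x, ε x ≠ 0 := by
      by_contra! h
      exact hε (Finsupp.ext fun x => (h x).symm)
    rw [coeff_genericSum_eq_zero (x := x), map_zero]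
    simpa using le_add_right (Nat.le_mul_of_pos_right _ (Nat.pos_of_ne_zero hx))

theorem frobeniusSplitsAt_genericSum {p e : ℕ} [ExpChar A p] (hq : p ^ e ≠ 0) {f : Fin s → A}
    {N : ℕ} (h : genericCartierIdeal c f (p ^ e) N = ⊤) :
    FrobeniusSplitsAt p e (genericSum c f (p ^ e) N) := by
  rw [frobeniusSplitsAt_iff_cartierIdeal]
  have := genericCartierIdeal_le hq f N (h ▸ Submodule.mem_top (x := (1 : A)))
  simpa using this

theorem coeff_nsmul_pow_expChar {σ : Type*} {p : ℕ} [ExpChar A p] (hp : p ≠ 0)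
    (x : MvPolynomial σ A) (γ : σ →₀ ℕ) : coeff (p • γ) (x ^ p) = coeff γ x ^ p := by
  classical
  induction x using MvPolynomial.induction_on' with
  | monomial δ a =>
    have h : p • δ = p • γ ↔ δ = γ := (nsmul_right_injective hp).eq_iff
    simp only [monomial_pow, coeff_monomial, h]
    split_ifs
    · rfl
    · rw [zero_pow hp]
  | add x y hx hy => rw [add_pow_expChar, coeff_add, coeff_add, add_pow_expChar, hx, hy]

theorem genericProd_pow (f : Fin s → A) (β : Fin c → ℕ) (m : ℕ) :
    genericProd f β ^ m = genericProd f fun i => m * β i := by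
  simp only [genericProd, ← Finset.prod_pow, ← pow_mul, mul_comm]

/-- The `p`-th power of a product has the `p`-th power of its coefficient at `p • γ`, and composing
`φ` with a splitting `τ` of Frobenius undoes that power. -/
theorem genericCartierIdeal_le_succ {p e : ℕ} [ExpChar A p] (hp : p ≠ 0)
    (h1 : (1 : A) ∈ cartierIdeal p 1) (f : Fin s → A) {N N' : ℕ} (hN : N' ≤ p * N) :
    genericCartierIdeal c f (p ^ e) N ≤ genericCartierIdeal c f (p ^ (e + 1)) N' := by
  obtain ⟨τ, hτ, hτ1⟩ := h1
  refine Ideal.span_le.2 ?_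
  rintro _ ⟨β, hβ, hβN, γ, φ, hφ, rfl⟩
  refine Ideal.subset_span ⟨fun i => p * β i, fun i => ?_, ?_, p • γ, φ.comp τ, ?_, ?_⟩
  · rw [pow_succ']
    exact Nat.mul_lt_mul_of_pos_left (hβ i) (Nat.pos_of_ne_zero hp)
  · rw [← Finset.mul_sum]
    exact hN.trans (Nat.mul_le_mul_left _ hβN)
  · rw [pow_succ]
    exact hφ.comp hτ
  · rw [← genericProd_pow, coeff_nsmul_pow_expChar hp, AddMonoidHom.comp_apply]
    conv_lhs => rw [← mul_one (_ ^ p), hτ, hτ1, mul_one]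

end GenericCombination

/-! ### Specialization at a point -/

section Points

variable {K L : Type*} [Field K] [Field L] {σ : Type*} [Finite σ] (p : ℕ) [ExpChar K p]
  [PerfectRing K p] [ExpChar L p] [PerfectRing L p] (e : ℕ) {c s : ℕ}

/-- If a product of powers of elements of the extension of `I = (f)` does not lie in the Frobenius
power of `M`, then the extension of `genericCartierIdeal` is not contained in `M`. -/
theorem exists_mem_genericCartierIdeal_map_notMem (φ : K →+* L) (f : Fin s → MvPolynomial σ K)
    {M : Ideal (MvPolynomial σ L)} {h : Fin c → MvPolynomial σ L}
    (hh : ∀ i, h i ∈ (Ideal.span (Set.range f)).map (map φ)) {β : Fin c → ℕ}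
    (hβ : ∀ i, β i < p ^ e) {N : ℕ} (hN : N ≤ ∑ i, β i)
    (hM : ∏ i, h i ^ β i ∉ M.map (iterateFrobenius (MvPolynomial σ L) p e)) :
    ∃ y ∈ genericCartierIdeal c f (p ^ e) N, map φ y ∉ M := by
  have h1 : ∀ i, ∃ a : Fin s → MvPolynomial σ L, ∑ j, a j * map φ (f j) = h i := fun i => by
    have := hh i
    rw [Ideal.map_span, ← Set.range_comp] at this
    exact (Ideal.mem_span_range_iff_exists_fun).1 this
  choose a ha using h1
  have h2 := eval₂_genericProd (map φ : MvPolynomial σ K →+* MvPolynomial σ L) a f β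
  simp only [ha] at h2
  rw [← h2, eval₂_eq] at hM
  obtain ⟨γ, hγ⟩ : ∃ γ, map φ (coeff γ (genericProd f β)) ∉
      M.map (iterateFrobenius (MvPolynomial σ L) p e) := by
    by_contra! hall
    exact hM (Ideal.sum_mem _ fun γ _ => Ideal.mul_mem_right _ _ (hall γ))
  obtain ⟨ρ, hρ, hρM⟩ := exists_cartierCoeff_notMem p e hγ
  refine ⟨cartierCoeff p e ρ (coeff γ (genericProd f β)), Ideal.subset_span ⟨β, hβ, hN, γ, _,
    isCartierMap_cartierCoeff p e hρ, rfl⟩, ?_⟩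
  rwa [map_cartierCoeff]

end Points

/-! ### Reductions modulo `M` and monomials outside Frobenius powers -/

section LocalReduction

variable {B : Type*} [CommRing B]

/-- `I` is generated up to integral closure by `r` of its elements, modulo `M * I ^ (m + 1)`; if
`B` is local with maximal ideal `M`, then `I` has a reduction generated by `r` elements. -/
def HasReductionModulo (I M : Ideal B) (r : ℕ) : Prop :=
  ∃ h : Fin r → B, (∀ i, h i ∈ I) ∧
    ∃ m, I ^ (m + 1) ≤ Ideal.span (Set.range h) * I ^ m ⊔ M * I ^ (m + 1)

theorem IsReduction.hasReductionModulo_map {A : Type*} [CommRing A] {I : Ideal A} {r : ℕ}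
    {h : Fin r → A} (hh : IsReduction (Ideal.span (Set.range h)) I) (φ : A →+* B) (M : Ideal B) :
    HasReductionModulo (I.map φ) M r := by
  obtain ⟨h1, m, hm⟩ := hh
  refine ⟨fun i => φ (h i), fun i => Ideal.mem_map_of_mem _ (h1 (Ideal.subset_span ⟨i, rfl⟩)), m,
    le_trans (le_of_eq ?_) le_sup_left⟩
  have h2 : Set.range (fun i => φ (h i)) = φ '' Set.range h := Set.range_comp φ h
  rw [h2, ← Ideal.map_span, ← Ideal.map_pow, ← Ideal.map_pow, ← Ideal.map_mul, hm]

theorem hasReductionModulo_span {s : ℕ} (f : Fin s → B) (M : Ideal B) :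
    HasReductionModulo (Ideal.span (Set.range f)) M s :=
  ⟨f, fun i => Ideal.subset_span ⟨i, rfl⟩, 0, by simp⟩

theorem HasReductionModulo.mono {I M : Ideal B} {r r' : ℕ} (h : HasReductionModulo I M r)
    (hr : r ≤ r') : HasReductionModulo I M r' := by
  obtain ⟨h, hI, m, hm⟩ := h
  refine ⟨fun i => if hi : (i : ℕ) < r then h ⟨i, hi⟩ else 0, fun i => ?_, m,
    hm.trans (sup_le_sup_right (Ideal.mul_mono_left (Ideal.span_mono ?_)) _)⟩
  · dsimp only
    split_ifs
    · exact hI _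
    · exact I.zero_mem
  · rintro _ ⟨i, rfl⟩
    exact ⟨Fin.castLE hr i, by simp⟩

/-- In place of localization and Nakayama: substituting the inclusion into itself replaces the error
factor `M` by `M ^ k`, which `Q` absorbs. The shift `m` does not depend on `k` or `Q`. -/
theorem pow_le_span_pow_sup {I M Q : Ideal B} {K : Ideal B} {m k : ℕ}
    (hm : I ^ (m + 1) ≤ K * I ^ m ⊔ M * I ^ (m + 1)) (hQ : M ^ k ≤ Q) (j : ℕ) :
    I ^ (m + j) ≤ K ^ j ⊔ Q := by
  have h1 : ∀ k, I ^ (m + 1) ≤ K * I ^ m ⊔ M ^ k * I ^ (m + 1) := by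
    intro k
    induction k with
    | zero => simp
    | succ k ih =>
      refine ih.trans (sup_le le_sup_left ?_)
      refine (Ideal.mul_mono_right hm).trans ?_
      rw [Ideal.mul_sup, ← mul_assoc (M ^ k) M, ← pow_succ]
      exact sup_le_sup_right Ideal.mul_le_right _
  have h2 : I ^ (m + 1) ≤ K * I ^ m ⊔ Q :=
    (h1 k).trans (sup_le_sup_left (Ideal.mul_le_left.trans hQ) _)
  have h3 : ∀ j, I ^ (m + j) ≤ K ^ j * I ^ m ⊔ Q := by
    intro j
    induction j with
    | zero => exact le_sup_of_le_left (by rw [pow_zero, one_mul, add_zero])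
    | succ j ih =>
      have e1 : I * (K ^ j * I ^ m ⊔ Q) ≤ K ^ j * I ^ (m + 1) ⊔ Q := by
        rw [Ideal.mul_sup, mul_left_comm, ← pow_succ']
        exact sup_le_sup_left Ideal.mul_le_right _
      have e2 : K ^ j * I ^ (m + 1) ≤ K ^ (j + 1) * I ^ m ⊔ Q := by
        refine (Ideal.mul_mono_right h2).trans ?_
        rw [Ideal.mul_sup, ← mul_assoc, ← pow_succ]
        exact sup_le_sup_left Ideal.mul_le_right _
      rw [← add_assoc, pow_succ']
      exact (Ideal.mul_mono_right ih).trans (e1.trans (sup_le e2 le_sup_right))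
  exact (h3 j).trans (sup_le_sup_right Ideal.mul_le_left _)

theorem exists_prod_pow_notMem {r j : ℕ} {h : Fin r → B} {Q : Ideal B}
    (hQ : ¬ Ideal.span (Set.range h) ^ j ≤ Q) :
    ∃ α : Fin r → ℕ, ∑ i, α i = j ∧ ∏ i, h i ^ α i ∉ Q := by
  by_contra! hall
  apply hQ
  intro y hy
  obtain ⟨G, hG, rfl⟩ := (Ideal.mem_span_pow_iff_exists_isHomogeneous h y).1 hy
  rw [eval_eq']
  refine Ideal.sum_mem _ fun d hd => Ideal.mul_mem_left _ _ (hall _ ?_)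
  have := hG (mem_support_iff.1 hd)
  rw [← this, Finsupp.weight_apply, Finsupp.sum_fintype] <;> simp

/-- Among `r` numbers, some `c` have at least `c / r` times the total sum. -/
theorem exists_injective_sum_le {c r : ℕ} (hcr : c ≤ r) (hr : r ≠ 0) (α : Fin r → ℕ) :
    ∃ τ : Fin c → Fin r, Function.Injective τ ∧ c * ∑ i, α i ≤ r * ∑ i, α (τ i) := by
  have : NeZero r := ⟨hr⟩
  -- Average over the cyclic windows of length `c`: each index lies in `c` of the `r` windows.
  have hsum : ∑ k : Fin r, c * ∑ i, α i ≤ ∑ k : Fin r, r * ∑ i : Fin c, α (k + Fin.castLE hcr i) := by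
    rw [← Finset.mul_sum (f := fun k : Fin r => ∑ i : Fin c, α (k + Fin.castLE hcr i)),
      Finset.sum_comm]
    have h1 : ∀ i : Fin c, ∑ k, α (k + Fin.castLE hcr i) = ∑ k, α k := fun i =>
      Equiv.sum_comp (Equiv.addRight (Fin.castLE hcr i)) α
    simp only [h1, Finset.sum_const, Finset.card_univ, Fintype.card_fin, smul_eq_mul]
    exact le_rfl
  obtain ⟨k, -, hk⟩ := Finset.exists_le_of_sum_le Finset.univ_nonempty hsum
  refine ⟨fun i => k + Fin.castLE hcr i, fun i j hij => ?_, hk⟩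
  exact Fin.castLE_injective hcr (add_left_cancel hij)

theorem prod_pow_notMem_of_injective {c r : ℕ} {h : Fin r → B} {α : Fin r → ℕ} {Q : Ideal B}
    (hQ : ∏ i, h i ^ α i ∉ Q) {τ : Fin c → Fin r} (hτ : Function.Injective τ) :
    ∏ i, h (τ i) ^ α (τ i) ∉ Q := by
  intro hmem
  refine hQ (Q.mem_of_dvd ?_ hmem)
  have := Finset.prod_map Finset.univ ⟨τ, hτ⟩ (fun i => h i ^ α i)
  rw [Function.Embedding.coeFn_mk] at this
  rw [← this]
  exact Finset.prod_dvd_prod_of_subset _ _ _ (Finset.subset_univ _)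

theorem HasReductionModulo.exists_prod_pow_notMem {p : ℕ} [ExpChar B p] {I M : Ideal B}
    (hM : M.FG) (hI : I ≤ M) {c r : ℕ} (hcr : c ≤ r) (hr : r ≠ 0) (h : HasReductionModulo I M r) :
    ∃ m, ∀ e j, ¬ I ^ (m + j) ≤ M.map (iterateFrobenius B p e) →
      j ≤ r * (p ^ e - 1) ∧ ∃ h : Fin c → B, (∀ i, h i ∈ I) ∧ ∃ β : Fin c → ℕ,
        (∀ i, β i < p ^ e) ∧ c * j ≤ r * ∑ i, β i ∧
        ∏ i, h i ^ β i ∉ M.map (iterateFrobenius B p e) := by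
  obtain ⟨h, hhI, m, hm⟩ := h
  refine ⟨m, fun e j hj => ?_⟩
  -- `k` depends on `e` but `m` was fixed beforehand; this uniformity keeps the loss in the
  -- threshold asymptotically negligible.
  obtain ⟨k, hk⟩ := exists_pow_le_map_iterateFrobenius (p := p) e hM
  obtain ⟨α, hα, hprod⟩ := GenericLinkage.exists_prod_pow_notMem
    (h := h) (j := j) (Q := M.map (iterateFrobenius B p e))
    fun hle => hj ((pow_le_span_pow_sup hm hk j).trans (sup_le hle le_rfl))
  have hαq : ∀ i, α i < p ^ e := by
    intro i
    by_contra! hi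
    refine hprod (Ideal.mem_of_dvd _ ((pow_dvd_pow _ hi).trans
      (Finset.dvd_prod_of_mem (fun i => h i ^ α i) (Finset.mem_univ i))) ?_)
    exact pow_mem_map_iterateFrobenius e (hI (hhI i))
  refine ⟨?_, ?_⟩
  · rw [← hα]
    refine (Finset.sum_le_card_nsmul _ _ (p ^ e - 1) fun i _ => Nat.le_sub_one_of_lt (hαq i)).trans ?_
    simp
  · obtain ⟨τ, hτ, hsum⟩ := exists_injective_sum_le hcr hr α
    exact ⟨fun i => h (τ i), fun i => hhI _, fun i => α (τ i), fun i => hαq _, hα ▸ hsum,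
      prod_pow_notMem_of_injective hprod hτ⟩

end LocalReduction

/-! ### Dropping a generator of a reduction -/

section LinearForms

variable {B : Type*} [CommRing B] {I K : Ideal B} {h₀ : B}

/-- Modulo `K` each `h i` is `l i * h₀`. The difference of the products of degree `a` lies in `K * I
^ (a - 1)`; the factor `y ∈ I` restores the exponent and avoids a special case at `a = 0`. -/
theorem mul_prod_sub_mem {ι : Type*} (S : Finset ι) {h l : ι → B} (α : ι → ℕ) (h0I : h₀ ∈ I)
    (hI : ∀ i, h i ∈ I) (hK : ∀ i, h i - l i * h₀ ∈ K) :
    ∏ i ∈ S, h i ^ α i ∈ I ^ ∑ i ∈ S, α i ∧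
      ∀ y ∈ I, y * (∏ i ∈ S, h i ^ α i - (∏ i ∈ S, l i ^ α i) * h₀ ^ ∑ i ∈ S, α i) ∈
        K * I ^ ∑ i ∈ S, α i := by
  let P : ℕ → B → B → Prop := fun a x t => x ∈ I ^ a ∧ ∀ y ∈ I, y * (x - t * h₀ ^ a) ∈ K * I ^ a
  have hP1 : P 0 1 1 := ⟨by simp, fun y _ => by simp⟩
  have hPmul : ∀ {a x t a' x' t'}, P a x t → P a' x' t' → P (a + a') (x * x') (t * t') := by
    rintro a x t a' x' t' ⟨hx, hx2⟩ ⟨hx', hx2'⟩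
    refine ⟨pow_add I a a' ▸ Ideal.mul_mem_mul hx hx', fun y hy => ?_⟩
    have : y * (x * x' - t * t' * h₀ ^ (a + a')) =
        (y * (x' - t' * h₀ ^ a')) * x + (y * (x - t * h₀ ^ a)) * (t' * h₀ ^ a') := by ring
    rw [this]
    refine Ideal.add_mem _ ?_ ?_
    · rw [add_comm a, pow_add, ← mul_assoc]
      exact Ideal.mul_mem_mul (hx2' y hy) hx
    · rw [pow_add, ← mul_assoc]
      exact Ideal.mul_mem_mul (hx2 y hy) (Ideal.mul_mem_left _ _ (Ideal.pow_mem_pow h0I _))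
  have hPpow : ∀ {x t} (n : ℕ), P 1 x t → P n (x ^ n) (t ^ n) := by
    intro x t n hx
    induction n with
    | zero => simpa using hP1
    | succ n ih => simpa only [pow_succ] using hPmul ih hx
  change P _ _ _
  classical
  induction S using Finset.induction_on with
  | empty => simpa using hP1
  | insert i S hi ih =>
    rw [Finset.prod_insert hi, Finset.prod_insert hi, Finset.sum_insert hi]
    refine hPmul (hPpow _ ⟨by simpa using hI i, fun y hy => ?_⟩) ih
    rw [pow_one, pow_one, mul_comm y]
    exact Ideal.mul_mem_mul (hK i) hy

theorem mul_aeval_sub_mem {L : Type*} [Field L] [Algebra L B] {ι : Type*} [Fintype ι]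
    {h : ι → B} (l : ι → L) (h0I : h₀ ∈ I) (hI : ∀ i, h i ∈ I)
    (hK : ∀ i, h i - algebraMap L B (l i) * h₀ ∈ K) {G : MvPolynomial ι L} {N : ℕ}
    (hG : G.IsHomogeneous N) {y : B} (hy : y ∈ I) :
    y * (aeval h G - algebraMap L B (eval l G) * h₀ ^ N) ∈ K * I ^ N := by
  have h1 : y * (aeval h G - algebraMap L B (eval l G) * h₀ ^ N) = ∑ d ∈ G.support,
      algebraMap L B (coeff d G) * (y * (∏ i, h i ^ d i -
        (∏ i, algebraMap L B (l i) ^ d i) * h₀ ^ N)) := by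
    rw [aeval_def, eval₂_eq', eval_eq', map_sum, Finset.sum_mul, ← Finset.sum_sub_distrib,
      Finset.mul_sum]
    refine Finset.sum_congr rfl fun d _ => ?_
    rw [map_mul, map_prod]
    simp only [map_pow]
    ring
  rw [h1]
  refine Ideal.sum_mem _ fun d hd => Ideal.mul_mem_left _ _ ?_
  have hdN : ∑ i, d i = N := by
    have := hG (mem_support_iff.1 hd)
    rw [← this, Finsupp.weight_apply, Finsupp.sum_fintype] <;> simp
  have := (mul_prod_sub_mem Finset.univ d h0I hI hK).2 y hy
  rwa [hdN] at this

/-- In the expansion every term except `h₀ ^ N` has a factor in `K`, and its other factors lie in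
`I`. -/
theorem sup_span_singleton_pow_mul_le (hKI : K ≤ I) (h0I : h₀ ∈ I) (N : ℕ) :
    (K ⊔ Ideal.span {h₀}) ^ N * I ≤ K * I ^ N ⊔ Ideal.span {h₀ ^ N} * I := by
  have h0 : Ideal.span {h₀} ≤ I := (Ideal.span_singleton_le_iff_mem I).2 h0I
  induction N with
  | zero => simp
  | succ N ih =>
    calc (K ⊔ Ideal.span {h₀}) ^ (N + 1) * I
        = (K ⊔ Ideal.span {h₀}) * ((K ⊔ Ideal.span {h₀}) ^ N * I) := by rw [pow_succ', mul_assoc]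
      _ ≤ (K ⊔ Ideal.span {h₀}) * (K * I ^ N ⊔ Ideal.span {h₀ ^ N} * I) := Ideal.mul_mono_right ih
      _ = (K ⊔ Ideal.span {h₀}) * (K * I ^ N) ⊔ (K * (Ideal.span {h₀ ^ N} * I) ⊔
            Ideal.span {h₀} * (Ideal.span {h₀ ^ N} * I)) := by rw [Ideal.mul_sup, Ideal.sup_mul _ _ (_ * I)]
      _ ≤ _ := by
        refine sup_le ?_ (sup_le ?_ ?_)
        · refine le_trans ?_ le_sup_left
          rw [mul_left_comm, pow_succ']
          exact Ideal.mul_mono_right (Ideal.mul_mono_left (sup_le hKI h0))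
        · refine le_trans ?_ le_sup_left
          rw [pow_succ]
          refine Ideal.mul_mono_right (Ideal.mul_mono_left ?_)
          rw [Ideal.span_singleton_le_iff_mem]
          exact Ideal.pow_mem_pow h0I N
        · refine le_trans (le_of_eq ?_) le_sup_right
          rw [← mul_assoc, Ideal.span_singleton_mul_span_singleton, pow_succ']

/-- A homogeneous relation between the generators of a reduction modulo `M` allows to drop one of
them, if the base field is infinite. -/
theorem HasReductionModulo.pred {L : Type*} [Field L] [Infinite L] [Algebra L B] {M : Ideal B}
    {ρ : ℕ} {h : Fin (ρ + 1) → B} (hI : ∀ i, h i ∈ I) {m : ℕ}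
    (hm : I ^ (m + 1) ≤ Ideal.span (Set.range h) * I ^ m ⊔ M * I ^ (m + 1))
    {G : MvPolynomial (Fin (ρ + 1)) L} {N : ℕ} (hG : G.IsHomogeneous N) (hG0 : G ≠ 0)
    (hGM : aeval h G ∈ M * Ideal.span (Set.range h) ^ N) : HasReductionModulo I M ρ := by
  -- The factor `X 0` forces `l 0 ≠ 0`, so that `h 0` can be rescaled to `h₀` and eliminated from
  -- the others.
  obtain ⟨l, hl⟩ : ∃ l : Fin (ρ + 1) → L, eval l (G * X 0) ≠ 0 := by
    by_contra! hall
    exact mul_ne_zero hG0 (X_ne_zero 0) (MvPolynomial.funext fun l => by rw [hall l, map_zero])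
  rw [map_mul, eval_X] at hl
  have hl0 := right_ne_zero_of_mul hl
  have hlG := left_ne_zero_of_mul hl
  set h₀ : B := algebraMap L B (l 0)⁻¹ * h 0 with hh₀
  have h0I : h₀ ∈ I := Ideal.mul_mem_left _ _ (hI 0)
  have h00 : h 0 = algebraMap L B (l 0) * h₀ := by
    rw [hh₀, ← mul_assoc, ← map_mul, mul_inv_cancel₀ hl0, map_one, one_mul]
  let h' : Fin ρ → B := fun i => h i.succ - algebraMap L B (l i.succ) * h₀
  have hh'I : ∀ i, h' i ∈ I := fun i => I.sub_mem (hI _) (I.mul_mem_left _ h0I)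
  set K := Ideal.span (Set.range h') with hK
  have hKI : K ≤ I := Ideal.span_le.2 (by rintro _ ⟨i, rfl⟩; exact hh'I i)
  have hhI : Ideal.span (Set.range h) ≤ I := Ideal.span_le.2 (by rintro _ ⟨i, rfl⟩; exact hI i)
  have hsub : ∀ i, h i - algebraMap L B (l i) * h₀ ∈ K := by
    refine Fin.cases ?_ fun i => ?_
    · rw [← h00, sub_self]
      exact K.zero_mem
    · exact Ideal.subset_span ⟨i, rfl⟩
  have hle : Ideal.span (Set.range h) ≤ K ⊔ Ideal.span {h₀} := by
    rw [Ideal.span_le]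
    rintro _ ⟨i, rfl⟩
    have := (K ⊔ Ideal.span {h₀}).add_mem (Ideal.mem_sup_left (hsub i))
      (Ideal.mem_sup_right (Ideal.mul_mem_left _ (algebraMap L B (l i))
        (Ideal.mem_span_singleton_self h₀)))
    simpa using this
  -- Modulo `K` the relation becomes `G(l) * h₀ ^ N` with `G(l)` a unit, so `h₀ ^ N` is negligible
  -- after multiplication by `I`.
  have h1 : Ideal.span {h₀ ^ N} * I ≤ K * I ^ N ⊔ M * I ^ (N + 1) := by
    rw [Ideal.span_singleton_mul_le_iff]
    intro y hy
    have h2 := mul_aeval_sub_mem l h0I hI hsub hG hy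
    have h3 : y * aeval h G ∈ M * I ^ (N + 1) := by
      rw [pow_succ, ← mul_assoc, mul_comm y]
      exact Ideal.mul_mem_mul (Ideal.mul_mono_right (Ideal.pow_right_mono hhI N) hGM) hy
    have h4 : h₀ ^ N * y = algebraMap L B (eval l G)⁻¹ *
        (y * aeval h G - y * (aeval h G - algebraMap L B (eval l G) * h₀ ^ N)) := by
      have : algebraMap L B (eval l G)⁻¹ * algebraMap L B (eval l G) = 1 := by
        rw [← map_mul, inv_mul_cancel₀ hlG, map_one]
      linear_combination (-(h₀ ^ N * y)) * this
    rw [h4]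
    exact Ideal.mul_mem_left _ _
      (Ideal.sub_mem _ (Ideal.mem_sup_right h3) (Ideal.mem_sup_left h2))
  have h5 : Ideal.span (Set.range h) ^ N * I ≤ K * I ^ N ⊔ M * I ^ (N + 1) :=
    (Ideal.mul_mono_left (Ideal.pow_right_mono hle N)).trans
      ((sup_span_singleton_pow_mul_le hKI h0I N).trans (sup_le le_sup_left h1))
  have h6 : ∀ j, I ^ (m + 1 + j) ≤
      Ideal.span (Set.range h) ^ j * I ^ (m + 1) ⊔ M * I ^ (m + 1 + j) := by
    intro j
    induction j with
    | zero => simp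
    | succ j ih =>
      calc I ^ (m + 1 + (j + 1)) = I ^ (m + 1 + j) * I := by rw [← add_assoc, pow_succ]
        _ ≤ (Ideal.span (Set.range h) ^ j * I ^ (m + 1) ⊔ M * I ^ (m + 1 + j)) * I :=
          Ideal.mul_mono_left ih
        _ = Ideal.span (Set.range h) ^ j * I * I ^ (m + 1) ⊔ M * I ^ (m + 1 + (j + 1)) := by
          rw [Ideal.sup_mul, mul_right_comm, mul_assoc M, ← pow_succ, add_assoc]
        _ ≤ Ideal.span (Set.range h) ^ j * I *
              (Ideal.span (Set.range h) * I ^ m ⊔ M * I ^ (m + 1)) ⊔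
              M * I ^ (m + 1 + (j + 1)) := sup_le_sup_right (Ideal.mul_mono_right hm) _
        _ ≤ _ := by
          rw [Ideal.mul_sup, sup_assoc]
          refine sup_le_sup (le_of_eq ?_) (sup_le ?_ le_rfl)
          · ring
          · calc Ideal.span (Set.range h) ^ j * I * (M * I ^ (m + 1))
                ≤ I ^ j * I * (M * I ^ (m + 1)) :=
                  Ideal.mul_mono_left (Ideal.mul_mono_left (Ideal.pow_right_mono hhI j))
              _ = _ := by ring
  refine ⟨h', hh'I, m + N, ?_⟩
  calc I ^ (m + N + 1) = I ^ (m + 1 + N) := by ring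
    _ ≤ Ideal.span (Set.range h) ^ N * I * I ^ m ⊔ M * I ^ (m + 1 + N) := by
      refine (h6 N).trans (le_of_eq ?_)
      rw [pow_succ', mul_assoc]
    _ ≤ (K * I ^ N ⊔ M * I ^ (N + 1)) * I ^ m ⊔ M * I ^ (m + 1 + N) :=
      sup_le_sup_right (Ideal.mul_mono_left h5) _
    _ = K * I ^ (m + N) ⊔ (M * I ^ (m + N + 1) ⊔ M * I ^ (m + N + 1)) := by
      rw [Ideal.sup_mul, sup_assoc]
      ring_nf
    _ = _ := by rw [sup_idem]

end LinearForms

/-! ### The bound `n` for the local analytic spread -/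

section AnalyticSpread

universe u

variable {L : Type u} [Field L]

theorem trdeg_polynomial_mvPolynomial (m : ℕ) :
    Algebra.trdeg L (Polynomial (MvPolynomial (Fin m) L)) = m + 1 := by
  rw [← trdeg_add_eq L (MvPolynomial (Fin m) L), MvPolynomial.trdeg_of_isDomain,
    Polynomial.trdeg_of_isDomain]
  simp

theorem coeff_aeval_C_mul_X {B : Type*} [CommRing B] [Algebra L B] {ι : Type*} [Fintype ι]
    (h : ι → B) (N : ℕ) (G : MvPolynomial ι L) :
    (aeval (fun i => Polynomial.C (h i) * Polynomial.X) G).coeff N =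
      aeval h (homogeneousComponent N G) := by
  induction G using MvPolynomial.induction_on' with
  | monomial d a =>
    have h1 : aeval (fun i => Polynomial.C (h i) * Polynomial.X) (monomial d a) =
        Polynomial.C (aeval h (monomial d a)) * Polynomial.X ^ d.degree := by
      simp only [aeval_monomial, mul_pow, map_mul, Finsupp.prod, map_prod,
        map_pow, Finset.prod_mul_distrib, Finset.prod_pow_eq_pow_sum, Polynomial.algebraMap_apply]
      rw [mul_assoc]
      rfl
    rw [h1, Polynomial.coeff_C_mul_X_pow,
      homogeneousComponent_of_mem (isHomogeneous_monomial a (n := d.degree) rfl)]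
    split_ifs <;> simp
  | add G G' h1 h2 => simp [h1, h2]

theorem aeval_mem_span_pow {B : Type*} [CommRing B] [Algebra L B] {ι : Type*} (h : ι → B) {N : ℕ}
    {G : MvPolynomial ι L} (hG : G.IsHomogeneous N) :
    aeval h G ∈ Ideal.span (Set.range h) ^ N := by
  rw [Ideal.mem_span_pow_iff_exists_isHomogeneous]
  refine ⟨map (algebraMap L B) G, hG.map _, ?_⟩
  rw [eval_map, aeval_def]

/-- More than `n` elements of a polynomial ring in `n` variables satisfy a nontrivial homogeneous
relation modulo any nonzero ideal. -/
theorem exists_homogeneous_relation {n r : ℕ} (hr : n < r) (h : Fin r → MvPolynomial (Fin n) L)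
    {M : Ideal (MvPolynomial (Fin n) L)} (hM : M ≠ ⊥) :
    ∃ (N : ℕ) (G : MvPolynomial (Fin r) L), G.IsHomogeneous N ∧ G ≠ 0 ∧
      aeval h G ∈ M * Ideal.span (Set.range h) ^ N := by
  obtain ⟨z, hzM, hz⟩ := Submodule.exists_mem_ne_zero_of_ne_bot hM
  -- The map `y_i ↦ h_i T`, with one more variable sent to `z ∈ M`, goes from transcendence degree
  -- `r + 1` to `n + 1`, hence has a kernel. The variable `T` records the degree in the `h_i`.
  let φ : MvPolynomial (Fin r) L →ₐ[L] Polynomial (MvPolynomial (Fin n) L) :=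
    aeval fun i => Polynomial.C (h i) * Polynomial.X
  let Φ : Polynomial (MvPolynomial (Fin r) L) →ₐ[L] Polynomial (MvPolynomial (Fin n) L) :=
    Polynomial.eval₂AlgHom φ (Polynomial.C z) fun _ => mul_comm _ _
  have hΦ : ∀ P, Φ P = P.eval₂ (φ : MvPolynomial (Fin r) L →+* _) (Polynomial.C z) := fun P => rfl
  have hinj : ¬ Function.Injective Φ := by
    intro hinj
    have h1 := trdeg_le_of_injective Φ hinj
    rw [trdeg_polynomial_mvPolynomial, trdeg_polynomial_mvPolynomial] at h1
    have : r + 1 ≤ n + 1 := by exact_mod_cast h1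
    omega
  obtain ⟨P, hP, hP0⟩ : ∃ P, Φ P = 0 ∧ P ≠ 0 := by
    by_contra! hall
    exact hinj ((injective_iff_map_eq_zero Φ).2 hall)
  -- As `z ≠ 0`, powers of the variable mapping to `z` can be cancelled, so the constant coefficient
  -- may be assumed nonzero. It yields the relation `G`; the other terms carry a factor `z`.
  obtain ⟨P', hPP', hX⟩ := Polynomial.exists_eq_pow_rootMultiplicity_mul_and_not_dvd P hP0 0
  rw [Polynomial.C_0, sub_zero] at hPP' hX
  rw [Polynomial.X_dvd_iff] at hX
  have hP' : Φ P' = 0 := by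
    rw [hPP', map_mul, map_pow] at hP
    refine (mul_eq_zero.1 hP).resolve_left (pow_ne_zero _ ?_)
    rw [hΦ, Polynomial.eval₂_X]
    exact Polynomial.C_ne_zero.2 hz
  obtain ⟨N, hN⟩ : ∃ N, homogeneousComponent N (P'.coeff 0) ≠ 0 := by
    by_contra! hall
    apply hX
    rw [← sum_homogeneousComponent (P'.coeff 0)]
    exact Finset.sum_eq_zero fun i _ => hall i
  refine ⟨N, _, homogeneousComponent_isHomogeneous N _, hN, ?_⟩
  have h2 : ∑ l ∈ Finset.range (P'.natDegree + 1),
      aeval h (homogeneousComponent N (P'.coeff l)) * z ^ l = 0 := by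
    have := congrArg (fun Q => Polynomial.coeff Q N) hP'
    simp only [hΦ, Polynomial.eval₂_eq_sum_range, Polynomial.finsetSum_coeff, ← Polynomial.C_pow,
      Polynomial.coeff_mul_C, Polynomial.coeff_zero] at this
    rw [← this]
    exact Finset.sum_congr rfl fun l _ => by rw [← coeff_aeval_C_mul_X]; rfl
  rw [Finset.sum_range_succ', pow_zero, mul_one] at h2
  rw [eq_neg_of_add_eq_zero_right h2]
  refine (M * Ideal.span (Set.range h) ^ N).neg_mem (Ideal.sum_mem _ fun l _ => ?_)
  rw [mul_comm (aeval h _)]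
  exact Ideal.mul_mem_mul (Ideal.pow_mem_of_mem _ hzM _ l.succ_pos)
    (aeval_mem_span_pow h (homogeneousComponent_isHomogeneous N _))

/-- Ideals of a polynomial ring in `n` variables over an infinite field have analytic spread at
most `n`. -/
theorem hasReductionModulo_of_infinite [Infinite L] {n s : ℕ} (f : Fin s → MvPolynomial (Fin n) L)
    {M : Ideal (MvPolynomial (Fin n) L)} (hM : M ≠ ⊥) :
    HasReductionModulo (Ideal.span (Set.range f)) M n := by
  have key : ∀ k, HasReductionModulo (Ideal.span (Set.range f)) M (n + k) →
      HasReductionModulo (Ideal.span (Set.range f)) M n := by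
    intro k
    induction k with
    | zero => exact id
    | succ k ih =>
      rintro ⟨h, hI, m, hm⟩
      obtain ⟨N, G, hG, hG0, hGM⟩ := exists_homogeneous_relation
        (Nat.lt_succ_of_le (Nat.le_add_right n k)) h hM
      exact ih (.pred hI hm hG hG0 hGM)
  exact key s ((hasReductionModulo_span f M).mono (Nat.le_add_left s n))

end AnalyticSpread

/-! ### Height bounds comparing `c` with the number of generators and with `n` -/

section Height

variable {A : Type*} [CommRing A] [IsNoetherianRing A]

/-- A prime containing the reduction contains a power of `I`, hence `I`; then Krull's height theorem
applies. -/
theorem height_le_of_isReduction {I : Ideal A} (hI : I ≠ ⊤) {r : ℕ} {h : Fin r → A}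
    (hh : IsReduction (Ideal.span (Set.range h)) I) : I.height ≤ r := by
  obtain ⟨hle, m, hm⟩ := hh
  have hK : Ideal.span (Set.range h) ≠ ⊤ := fun htop => hI (top_le_iff.1 (htop ▸ hle))
  have h1 : I.height ≤ (Ideal.span (Set.range h)).height := by
    rw [Ideal.height_eq_inf_minimalPrimes (Ideal.span _)]
    refine le_iInf₂ fun P hP => ?_
    have : P.IsPrime := hP.1.1
    refine Ideal.height_mono (Ideal.IsPrime.le_of_pow_le (n := m + 1) ?_)
    exact hm.le.trans (Ideal.mul_le_left.trans hP.1.2)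
  refine h1.trans ((Ideal.height_le_spanFinrank _ hK).trans ?_)
  have := Submodule.spanFinrank_span_le_ncard_of_finite (R := A) (Set.finite_range h)
  refine Nat.cast_le.2 (this.trans ?_)
  rw [← Set.image_univ]
  refine (Set.ncard_image_le Set.finite_univ).trans ?_
  simp

/-- After localization at a minimal prime the sequence stays regular, and its length is subtracted
from the dimension. -/
theorem length_le_height_of_isRegular {l : List A} (hl : RingTheory.Sequence.IsRegular A l) :
    (l.length : ℕ∞) ≤ (Ideal.ofList l).height := by
  rw [Ideal.height_eq_inf_minimalPrimes]
  refine le_iInf₂ fun P hP => ?_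
  have : P.IsPrime := hP.1.1
  have h1 := hl.toIsWeaklyRegular.isRegular_of_isLocalization_of_mem (Localization.AtPrime P) P
    fun x hx => hP.1.2 (Ideal.subset_span hx)
  have h2 := ringKrullDim_add_length_eq_ringKrullDim_of_isRegular _ h1
  rw [IsLocalization.AtPrime.ringKrullDim_eq_height P (Localization.AtPrime P),
    List.length_map] at h2
  obtain ⟨D, hD⟩ : ∃ D : WithBot ℕ∞, D + l.length = P.height := ⟨_, h2⟩
  induction D using WithBot.recBotCoe with
  | bot => exact absurd hD (by simp)
  | coe D =>
    have h3 : D + l.length = P.height := by exact_mod_cast hD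
    exact h3 ▸ le_add_self

theorem height_le_of_mvPolynomial {K : Type*} [Field K] {n : ℕ} {I : Ideal (MvPolynomial (Fin n) K)}
    (hI : I ≠ ⊤) : I.height ≤ n := by
  have h1 : (I.height : WithBot ℕ∞) ≤ ringKrullDim (MvPolynomial (Fin n) K) :=
    Ideal.height_le_ringKrullDim_of_ne_top hI
  rw [MvPolynomial.ringKrullDim_of_isNoetherianRing, ringKrullDim_eq_zero_of_field] at h1
  simp at h1
  exact_mod_cast h1

end Height

/-! ### From points to thresholds -/

open Filter (atTop eventually_ge_atTop)

/-- Both sides are linear in `p ^ e` up to bounded error, so the strict inequality of slopes absorbs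
the rounding and the shift `m`. -/
theorem eventually_mul_ceil_add_le {p c r : ℕ} (hp : 1 < p) {t t' : ℝ≥0}
    (h : (r : ℝ≥0) * t' < c * t) (m : ℕ) :
    ∀ᶠ e : ℕ in atTop, r * ⌈(t' : ℝ) * (p : ℝ) ^ e⌉₊ + c * m ≤
      c * ⌊(t : ℝ) * ((p : ℝ) ^ e - 1)⌋₊ := by
  have h' : (0 : ℝ) < c * t - r * t' := sub_pos.2 (by exact_mod_cast h)
  have hlim := tendsto_pow_atTop_atTop_of_one_lt (r := (p : ℝ)) (by exact_mod_cast hp)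
  filter_upwards [hlim.eventually_ge_atTop ((r + c * t + c + c * m) / (c * t - r * t'))] with e he
  rw [div_le_iff₀ h'] at he
  have h1 := (Nat.ceil_lt_add_one (a := (t' : ℝ) * (p : ℝ) ^ e) (by positivity)).le
  have h2 := (Nat.lt_floor_add_one ((t : ℝ) * ((p : ℝ) ^ e - 1))).le
  have h3 := mul_le_mul_of_nonneg_left h1 (Nat.cast_nonneg (α := ℝ) r)
  have h4 := mul_le_mul_of_nonneg_left h2 (Nat.cast_nonneg (α := ℝ) c)
  have : (r * ⌈(t' : ℝ) * (p : ℝ) ^ e⌉₊ + c * m : ℝ) ≤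
      c * ⌊(t : ℝ) * ((p : ℝ) ^ e - 1)⌋₊ := by
    linarith
  exact_mod_cast this

section

variable {k : Type*} [Field k] (p : ℕ) [ExpChar k p] [PerfectRing k p] {n c r s : ℕ}

theorem map_mem_vanishingIdeal_iff {L : Type*} [Field L] [Algebra k L] (a : Fin n → L)
    (y : MvPolynomial (Fin n) k) :
    map (algebraMap k L) y ∈ vanishingIdeal L {a} ↔ aeval a y = 0 := by
  rw [mem_vanishingIdeal_singleton_iff, aeval_map_algebraMap]

theorem map_iterateFrobenius_le {B : Type*} [CommRing B] [ExpChar B p] (M : Ideal B) (e : ℕ)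
    (hq : p ^ e ≠ 0) : M.map (iterateFrobenius B p e) ≤ M :=
  Ideal.map_le_iff_le_comap.2 fun x hx => by
    rw [Ideal.mem_comap, iterateFrobenius_def]
    exact Ideal.pow_mem_of_mem _ hx _ (Nat.pos_of_ne_zero hq)

variable {p} {L : Type*} [Field L] [Algebra k L] [ExpChar L p] [PerfectRing L p]

theorem eventually_exists_prod_notMem (hp : 1 < p) {I : Ideal (MvPolynomial (Fin n) k)}
    (hcr : c ≤ r) (hr : r ≠ 0) {t t' : ℝ≥0} (ht : IsFPurePair p I t)
    (h : (r : ℝ≥0) * t' < c * t) {a : Fin n → L} (ha : ∀ y ∈ I, aeval a y = 0)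
    (hred : HasReductionModulo (I.map (map (algebraMap k L))) (vanishingIdeal L {a}) r) :
    ∀ᶠ e : ℕ in atTop, ⌈(t' : ℝ) * (p : ℝ) ^ e⌉₊ ≤ c * (p ^ e - 1) ∧
      ∃ h : Fin c → MvPolynomial (Fin n) L, (∀ i, h i ∈ I.map (map (algebraMap k L))) ∧
        ∃ β : Fin c → ℕ, (∀ i, β i < p ^ e) ∧ ⌈(t' : ℝ) * (p : ℝ) ^ e⌉₊ ≤ ∑ i, β i ∧
          ∏ i, h i ^ β i ∉
            (vanishingIdeal L {a}).map (iterateFrobenius (MvPolynomial (Fin n) L) p e) := by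
  have hc : 0 < c := by
    rw [Nat.pos_iff_ne_zero]
    rintro rfl
    simp at h
  have hIM : I.map (map (algebraMap k L)) ≤ vanishingIdeal L {a} :=
    Ideal.map_le_iff_le_comap.2 fun y hy => (map_mem_vanishingIdeal_iff a y).2 (ha y hy)
  obtain ⟨m, hm⟩ := hred.exists_prod_pow_notMem (p := p) (IsNoetherian.noetherian _) hIM hcr hr
  filter_upwards [eventually_mul_ceil_add_le hp h m, ht] with e he ⟨d, hd, hsplit⟩
  have hle : m ≤ ⌊(t : ℝ) * ((p : ℝ) ^ e - 1)⌋₊ :=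
    Nat.le_of_mul_le_mul_left (le_of_add_le_right he) hc
  obtain ⟨j, hj⟩ := Nat.exists_eq_add_of_le hle
  rw [hj] at hd he
  have hprime : (vanishingIdeal L {a}).IsPrime := inferInstance
  have hnot : ¬ I.map (map (algebraMap k L)) ^ (m + j) ≤
      (vanishingIdeal L {a}).map (iterateFrobenius (MvPolynomial (Fin n) L) p e) := by
    intro hall
    refine map_notMem_of_one_mem_cartierIdeal p e (algebraMap k L) hprime.ne_top
      (frobeniusSplitsAt_iff_cartierIdeal.1 hsplit) (hall ?_)
    rw [← Ideal.map_pow]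
    exact Ideal.mem_map_of_mem _ hd
  obtain ⟨hj1, h', hh', β, hβ, hsum, hprod⟩ := hm e j hnot
  have h1 : r * ⌈(t' : ℝ) * (p : ℝ) ^ e⌉₊ ≤ c * j := by
    rw [mul_add] at he
    omega
  refine ⟨Nat.le_of_mul_le_mul_left (h1.trans ?_) (Nat.pos_of_ne_zero hr), h', hh', β, hβ,
    Nat.le_of_mul_le_mul_left (h1.trans hsum) (Nat.pos_of_ne_zero hr), hprod⟩
  rw [mul_left_comm]
  exact Nat.mul_le_mul_left c hj1

variable (L) in
/-- If locally `I = (f)` has a reduction generated by `r` elements at every point of an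
algebraically closed field, then `F`-purity of `(R, I ^ t)` implies `F`-purity of `(S, J ^ t')` for
`t' < (c / r) * t`. -/
theorem isFPurePair_genericLink [IsAlgClosed L] (hp : 1 < p) (f : Fin s → MvPolynomial (Fin n) k)
    (hI : Ideal.span (Set.range f) ≠ ⊤) (hcr : c ≤ r) (hr : r ≠ 0) {t t' : ℝ≥0}
    (ht : IsFPurePair p (Ideal.span (Set.range f)) t) (h : (r : ℝ≥0) * t' < c * t)
    (hred : ∀ a : Fin n → L, HasReductionModulo
      ((Ideal.span (Set.range f)).map (map (algebraMap k L))) (vanishingIdeal L {a}) r) :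
    IsFPurePair p (genericLink c f) t' := by
  set I := Ideal.span (Set.range f) with hIdef
  have hq : ∀ e, p ^ e ≠ 0 := expChar_pow_ne_zero k p
  have exists_point : ∀ J : Ideal (MvPolynomial (Fin n) k), J ≠ ⊤ →
      ∃ a : Fin n → L, ∀ y ∈ J, aeval a y = 0 := by
    intro J hJ
    obtain ⟨M, hM, hJM⟩ := J.exists_le_maximal hJ
    obtain ⟨a, rfl⟩ := eq_vanishingIdeal_singleton_of_isMaximal L hM
    exact ⟨a, fun y hy => (mem_vanishingIdeal_singleton_iff a y).1 (hJM hy)⟩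
  -- Rounding `t' * q` up gives `N (e + 1) ≤ p * N e`, which makes `E` increasing, and still
  -- dominates the exponent `⌊t' * (q - 1)⌋` required by `F`-purity.
  let N : ℕ → ℕ := fun e => ⌈(t' : ℝ) * (p : ℝ) ^ e⌉₊
  let E : ℕ → Ideal (MvPolynomial (Fin n) k) := fun e => genericCartierIdeal c f (p ^ e) (N e)
  have hmono : Monotone E := by
    refine monotone_nat_of_le_succ fun e => ?_
    refine genericCartierIdeal_le_succ (by omega)
      (by simpa using one_mem_cartierIdeal_one (K := k) (σ := Fin n) p 1) f ?_
    refine Nat.ceil_le.2 ?_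
    have := Nat.le_ceil ((t' : ℝ) * (p : ℝ) ^ e)
    calc (t' : ℝ) * (p : ℝ) ^ (e + 1) = p * (t' * (p : ℝ) ^ e) := by ring
      _ ≤ p * (N e : ℝ) := by gcongr
      _ = _ := by push_cast; rfl
  obtain ⟨a₀, ha₀⟩ := exists_point I hI
  have hpoint : ∀ a : Fin n → L, ∃ e, ∃ y ∈ E e, aeval a y ≠ 0 := by
    intro a
    have hprime : (vanishingIdeal L {a}).IsPrime := inferInstance
    suffices hs : ∃ e, ∃ h : Fin c → MvPolynomial (Fin n) L,
        (∀ i, h i ∈ I.map (map (algebraMap k L))) ∧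
        ∃ β : Fin c → ℕ, (∀ i, β i < p ^ e) ∧ N e ≤ ∑ i, β i ∧ ∏ i, h i ^ β i ∉
            (vanishingIdeal L {a}).map (iterateFrobenius (MvPolynomial (Fin n) L) p e) by
      obtain ⟨e, h', hh', β, hβ, hN, hprod⟩ := hs
      obtain ⟨y, hy, hyM⟩ := exists_mem_genericCartierIdeal_map_notMem p e (algebraMap k L) f hh'
        hβ hN hprod
      exact ⟨e, y, hy, fun h0 => hyM ((map_mem_vanishingIdeal_iff a y).2 h0)⟩
    by_cases ha : ∀ y ∈ I, aeval a y = 0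
    · obtain ⟨e, -, he⟩ := (eventually_exists_prod_notMem hp hcr hr ht h ha (hred a)).exists
      exact ⟨e, he⟩
    · push Not at ha
      obtain ⟨y, hy, hya⟩ := ha
      -- Off `V(I)` all exponents can be `q - 1`. The needed bound `N e ≤ c * (q - 1)` comes from
      -- the point `a₀` of `V(I)`.
      obtain ⟨e, he, -⟩ := (eventually_exists_prod_notMem hp hcr hr ht h ha₀ (hred a₀)).exists
      refine ⟨e, fun _ => map (algebraMap k L) y, fun _ => Ideal.mem_map_of_mem _ hy,
        fun _ => p ^ e - 1, fun _ => Nat.sub_one_lt (hq e),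
        he.trans_eq (by simp), fun hmem => ?_⟩
      refine hya ((map_mem_vanishingIdeal_iff a y).1 ?_)
      obtain ⟨i, -, hi⟩ := hprime.prod_mem_iff.1 (map_iterateFrobenius_le p _ e (hq e) hmem)
      exact hprime.mem_of_pow_mem _ hi
  have htop : ⨆ e, E e = ⊤ := by
    by_contra hne
    obtain ⟨a, ha⟩ := exists_point _ hne
    obtain ⟨e, y, hy, hya⟩ := hpoint a
    exact hya (ha y (le_iSup E e hy))
  obtain ⟨e₀, he₀⟩ : ∃ e₀, (1 : MvPolynomial (Fin n) k) ∈ E e₀ :=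
    (Submodule.mem_iSup_of_directed E hmono.directed_le).1 (htop ▸ Submodule.mem_top)
  filter_upwards [eventually_ge_atTop e₀] with e he
  refine ⟨genericSum c f (p ^ e) (N e), ?_,
    frobeniusSplitsAt_genericSum (hq e) ((Ideal.eq_top_iff_one _).2 (hmono he he₀))⟩
  refine Ideal.pow_le_pow_right (m := ⌊(t' : ℝ) * ((p : ℝ) ^ e - 1)⌋₊) (n := N e) ?_
    (Ideal.pow_right_mono (span_genericCombination_le_genericLink f) _ (genericSum_mem_pow f _ _))
  refine (Nat.floor_le_floor ?_).trans (Nat.floor_le_ceil _)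
  exact mul_le_mul_of_nonneg_left (by linarith) t'.2

variable (L) in
theorem div_mul_fpt_le_fpt_genericLink [IsAlgClosed L] (hp : 1 < p)
    (f : Fin s → MvPolynomial (Fin n) k)
    (hI : Ideal.span (Set.range f) ≠ ⊤) (hcr : c ≤ r) (hr : r ≠ 0)
    (hred : ∀ a : Fin n → L, HasReductionModulo
      ((Ideal.span (Set.range f)).map (map (algebraMap k L))) (vanishingIdeal L {a}) r) :
    ((c : ℝ≥0∞) / (r : ℝ≥0∞)) * fpt p (Ideal.span (Set.range f)) ≤ fpt p (genericLink c f) := by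
  rw [fpt]
  simp only [ENNReal.mul_iSup]
  refine iSup₂_le fun t ht => ENNReal.le_of_forall_nnreal_lt fun t' ht' => ?_
  refine le_iSup₂_of_le t' (isFPurePair_genericLink L hp f hI hcr hr ht ?_ hred) le_rfl
  have hr0 : (r : ℝ≥0) ≠ 0 := by exact_mod_cast hr
  have h1 : t' < (c : ℝ≥0) / r * t := by
    rw [← ENNReal.coe_lt_coe, ENNReal.coe_mul, ENNReal.coe_div hr0, ENNReal.coe_natCast,
      ENNReal.coe_natCast]
    exact ht'
  have h2 := mul_lt_mul_of_pos_left h1 (pos_iff_ne_zero.2 hr0)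
  rwa [← mul_assoc, mul_div_cancel₀ _ hr0] at h2

variable (p) in
theorem fpt_top : fpt p (⊤ : Ideal (MvPolynomial (Fin c × Fin s) (MvPolynomial (Fin n) k))) = ⊤ := by
  rw [eq_top_iff]
  refine ENNReal.le_of_forall_nnreal_lt fun t _ => le_iSup₂_of_le t ?_ le_rfl
  refine .of_forall fun e => ⟨1, by simp [Ideal.top_pow], ?_⟩
  rw [frobeniusSplitsAt_iff]
  obtain ⟨φ, hφ, h1⟩ := one_mem_cartierIdeal_one (K := k) (σ := Fin n) p e
  have hq := expChar_pow_ne_zero k p e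
  refine ⟨cartierLift hq φ 0, isCartierMap_cartierLift hq hφ fun _ => Nat.pos_of_ne_zero hq, ?_⟩
  classical
  refine MvPolynomial.ext _ _ fun ε => ?_
  rw [coeff_cartierLift, coeff_one, coeff_one]
  have : (0 = p ^ e • ε + 0) ↔ 0 = ε := by
    rw [add_zero, eq_comm, smul_eq_zero_iff_right hq, eq_comm]
  simp only [this]
  split_ifs
  · exact h1
  · exact map_zero φ

end

end GenericLinkage

end

theorem corollary4p4
    {k : Type*} [Field k] [PerfectField k] (p : ℕ) [Fact p.Prime] [CharP k p]
    (n : ℕ) (I : Ideal (MvPolynomial (Fin n) k)) (hI : GenericLinkage.IsUnmixed I)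
    (c : ℕ) (hc : I.height = (c : ℕ∞))
    {s : ℕ} (f : Fin s → MvPolynomial (Fin n) k) (hf : Ideal.span (Set.range f) = I) :
    -- a reduction generated by `r` elements
    (∀ (r : ℕ) (h : Fin r → MvPolynomial (Fin n) k),
      GenericLinkage.IsReduction (Ideal.span (Set.range h)) I →
        ((c : ℝ≥0∞) / (r : ℝ≥0∞)) * GenericLinkage.fpt p I ≤
          GenericLinkage.fpt p (GenericLinkage.genericLink c f)) ∧
    -- a reduction generated by `c` elements
    (∀ h : Fin c → MvPolynomial (Fin n) k,
      GenericLinkage.IsReduction (Ideal.span (Set.range h)) I →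
        GenericLinkage.fpt p I ≤ GenericLinkage.fpt p (GenericLinkage.genericLink c f)) ∧
    -- in particular, complete intersections
    (GenericLinkage.IsCompleteIntersection I →
      GenericLinkage.fpt p I ≤ GenericLinkage.fpt p (GenericLinkage.genericLink c f)) ∧
    -- in general
    ((c : ℝ≥0∞) / (n : ℝ≥0∞)) * GenericLinkage.fpt p I ≤
      GenericLinkage.fpt p (GenericLinkage.genericLink c f) := by
  subst hf
  have hp : 1 < p := (Fact.out : p.Prime).one_lt
  have htop : Ideal.span (Set.range f) ≠ ⊤ := by
    intro h
    rw [h, Ideal.height_top] at hc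
    exact ENat.top_ne_natCast c hc
  have hfactor : ∀ (r : ℕ) (h : Fin r → MvPolynomial (Fin n) k),
      GenericLinkage.IsReduction (Ideal.span (Set.range h)) (Ideal.span (Set.range f)) →
        ((c : ℝ≥0∞) / (r : ℝ≥0∞)) * GenericLinkage.fpt p (Ideal.span (Set.range f)) ≤
          GenericLinkage.fpt p (GenericLinkage.genericLink c f) := by
    intro r h hh
    rcases eq_or_ne c 0 with rfl | hc0
    -- Here `0 / r = 0`, also for `r = 0`, so the left side vanishes.
    · simp
    have hcr : c ≤ r := by
      have := GenericLinkage.height_le_of_isReduction htop hh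
      rw [hc] at this
      exact_mod_cast this
    exact GenericLinkage.div_mul_fpt_le_fpt_genericLink (AlgebraicClosure k) hp f htop hcr
      (by omega) fun a => hh.hasReductionModulo_map _ _
  have hself : ∀ h : Fin c → MvPolynomial (Fin n) k,
      GenericLinkage.IsReduction (Ideal.span (Set.range h)) (Ideal.span (Set.range f)) →
        GenericLinkage.fpt p (Ideal.span (Set.range f)) ≤
          GenericLinkage.fpt p (GenericLinkage.genericLink c f) := by
    intro h hh
    rcases eq_or_ne c 0 with rfl | hc0
    · have hbot := Ideal.height_eq_zero_iff_eq_bot.1 hc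
      have hlink : GenericLinkage.genericLink 0 f = ⊤ := by
        rw [GenericLinkage.genericLink, hbot, Ideal.map_bot, eq_top_iff]
        intro x _
        rw [Submodule.mem_colon]
        rintro y rfl
        simp
      rw [hlink, GenericLinkage.fpt_top]
      exact le_top
    · have := hfactor c h hh
      rwa [ENNReal.div_self (by exact_mod_cast hc0) (ENNReal.natCast_ne_top c), one_mul] at this
  refine ⟨hfactor, hself, ?_, ?_⟩
  · rintro ⟨l, hl, hlI⟩
    have hrange : Ideal.span (Set.range l.get) = Ideal.span (Set.range f) := by
      rw [← hlI, Set.range_list_get]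
    have hred : GenericLinkage.IsReduction (Ideal.span (Set.range l.get)) (Ideal.span (Set.range f)) :=
      ⟨hrange.le, 0, by rw [hrange, zero_add, pow_one, pow_zero, mul_one]⟩
    have h1 := GenericLinkage.length_le_height_of_isRegular hl
    have h2 := GenericLinkage.height_le_of_isReduction htop hred
    rw [hlI, hc] at h1
    rw [hc] at h2
    have h3 : c = l.length := le_antisymm (by exact_mod_cast h2) (by exact_mod_cast h1)
    subst h3
    exact hself _ hred
  · rcases eq_or_ne c 0 with rfl | hc0
    · simp
    have hcn : c ≤ n := by
      have := GenericLinkage.height_le_of_mvPolynomial htop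
      rw [hc] at this
      exact_mod_cast this
    have hn : n ≠ 0 := by omega
    refine GenericLinkage.div_mul_fpt_le_fpt_genericLink (AlgebraicClosure k) hp f htop hcn hn
      fun a => ?_
    rw [Ideal.map_span, ← Set.range_comp]
    refine GenericLinkage.hasReductionModulo_of_infinite _ fun hbot => ?_
    -- A point ideal is nonzero because `n > 0`: it contains `X - a`, of degree `1`.
    have hX : MvPolynomial.X ⟨0, Nat.pos_of_ne_zero hn⟩ -
        MvPolynomial.C (a ⟨0, Nat.pos_of_ne_zero hn⟩) ∈
        MvPolynomial.vanishingIdeal (AlgebraicClosure k) {a} := by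
      rw [MvPolynomial.mem_vanishingIdeal_singleton_iff]
      simp
    rw [hbot, Ideal.mem_bot, sub_eq_zero] at hX
    have := congrArg MvPolynomial.totalDegree hX
    simp at this
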